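/- Let $n$ be a natural number. Let $\mathrm{Cl}(\mathbb R^{2n})$ be the real Clifford algebra of $\mathbb R^{2n}$ with $v^2=-\|v\|^2$, and let $\mathrm{Spin}(2n)\subset \mathrm{Cl}(\mathbb R^{2n})$ be the compact spin group, i.e. the group of even elements $x$ that are products of invertible vectors and satisfy $x\,\gamma(x)=\gamma(x)\,x=1$, where $\gamma$ is the anti-automorphism of $\mathrm{Cl}(\mathbb R^{2n})$ with $\gamma(v)=-v$ for $v\in\mathbb R^{2n}$. For $v\in\mathbb C^n$ let $l_v\xi=v\wedge\xi$ be the creation operator on the exterior algebra $\Lambda^*\mathbb C^n$, and let $\iota_v$ be the annihilation operator, i.e. contraction with $v$ through the standard Hermitian inner product: $$\iota_v(w_1\wedge\cdots\wedge w_k)=\sum_{j=1}^k(-1)^{j+1}\langle v,w_j\rangle\,w_1\wedge\cdots\wedge\widehat{w_j}\wedge\cdots\wedge w_k .$$ Identify $\mathbb R^{2n}$ with $\mathbb C^n$ by $(x_1,\dots,x_n,y_1,\dots,y_n)\mapsto(x_j+iy_j)_j$. The map $v\mapsto l_v-\iota_v$ satisfies $(l_v-\iota_v)^2=-\|v\|^2$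 and so makes $\Lambda^*\mathbb C^n$ a module over $\mathrm{Cl}(\mathbb R^{2n})$. Let $\rho'$ be its restriction to $\mathrm{Spin}(2n)$, the Dirac spinor representation. Let $\rho$ be the representation of $\mathrm{SU}(n)$ on $\Lambda^*\mathbb C^n$ by algebra automorphisms that is the fundamental representation on $\Lambda^1\mathbb C^n=\mathbb C^n$, i.e. $\rho(g)(w_1\wedge\cdots\wedge w_k)=gw_1\wedge\cdots\wedge gw_k$. Then there is a homomorphism of Lie groups (a smooth group homomorphism) $\psi:\mathrm{SU}(n)\to\mathrm{Spin}(2n)$ such that $\rho'\circ\psi=\rho$. Smoothness refers to the embedded manifolds $\mathrm{SU}(n)\subset M_n(\mathbb C)$ and $\mathrm{Spin}(2n)\subset\mathrm{Cl}(\mathbb R^{2n})$: around every point of $\mathrm{SU}(n)$, $\psi$ is the restriction of a $C^\infty$ map from an open subset of $M_n(\mathbb C)$ to $\mathrm{Cl}(\mathbb R^{2n})$. -/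

import Mathlib

open scoped ContDiff

noncomputable section

namespace SpinSU

/-! ### The spin groups -/

/-- The negative definite quadratic form `v ↦ -∑ vᵢ²` on `ℝᵐ`. -/
abbrev negForm (m : ℕ) : QuadraticForm ℝ (Fin m → ℝ) :=
  QuadraticMap.weightedSumSquares ℝ (fun _ : Fin m => (-1 : ℝ))

/-- The real Clifford algebra of `ℝᵐ`, in which `v * v = -‖v‖²`. -/
abbrev Cl (m : ℕ) : Type := CliffordAlgebra (negForm m)

/-- The compact spin group `Spin(m)`, inside the even part of the Clifford algebra of `ℝᵐ`. -/
abbrev Spin (m : ℕ) : Submonoid (Cl m) := spinGroup (negForm m)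

/-- The special unitary group `SU(n)`. -/
abbrev SU (n : ℕ) : Submonoid (Matrix (Fin n) (Fin n) ℂ) :=
  Matrix.specialUnitaryGroup (Fin n) ℂ

instance exteriorAlgebra_finite (K M : Type*) [Field K] [AddCommGroup M] [Module K M]
    [FiniteDimensional K M] : FiniteDimensional K (ExteriorAlgebra K M) := by
  exact Module.Finite.of_basis (Module.finBasis K M).ExteriorAlgebra

instance finiteDimensional_cl (m : ℕ) : FiniteDimensional ℝ (Cl m) :=
  Module.Finite.equiv (CliffordAlgebra.equivExterior (negForm m)).symm

/-! ### Homomorphisms of embedded Lie groups -/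

/-- Let `S` and `T` be Lie groups embedded, with the restricted product, as submanifolds in
finite-dimensional real vector spaces `A` and `B`. A homomorphism of groups `ψ : S → T` is a
homomorphism of Lie groups if it is a smooth map, that is, if around every point of `S` it is the
restriction of a `C^∞` map from an open subset of `A` to `B`. Smoothness of a map into the
finite-dimensional space `B` is smoothness of all its coordinates (so no norm on `B` is chosen). -/
def IsLieGroupHom {A B : Type*} [Monoid A] [NormedAddCommGroup A] [NormedSpace ℝ A]
    [FiniteDimensional ℝ A] [Ring B] [Algebra ℝ B] [FiniteDimensional ℝ B]
    {S : Submonoid A} {T : Submonoid B} (ψ : S →* T) : Prop :=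
  ∀ x : S, ∃ (U : Set A) (F : A → B), IsOpen U ∧ (x : A) ∈ U ∧
    (∀ l : Module.Dual ℝ B, ContDiffOn ℝ ∞ (fun a => l (F a)) U) ∧
    ∀ y : S, (y : A) ∈ U → F y = ψ y

/-! ### The two representations on the exterior algebra of `ℂⁿ` -/

/-- The exterior algebra `Λ*ℂⁿ`. -/
abbrev Ext (n : ℕ) : Type := ExteriorAlgebra ℂ (Fin n → ℂ)

/-- The natural representation of `SU(n)` on `Λ*ℂⁿ`: the fundamental representation on
`Λ¹ℂⁿ = ℂⁿ`, extended by `g (v ∧ w) = g v ∧ g w`. -/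
def extRep (n : ℕ) : Representation ℂ (SU n) (Ext n) where
  toFun g := (ExteriorAlgebra.map (Matrix.toLin' (g : Matrix (Fin n) (Fin n) ℂ))).toLinearMap
  map_one' := by
    rw [OneMemClass.coe_one, Matrix.toLin'_one, ExteriorAlgebra.map_id]
    rfl
  map_mul' g h := by
    rw [Submonoid.coe_mul, Matrix.toLin'_mul, ← ExteriorAlgebra.map_comp_map]
    rfl

/-- The creation operator `ξ ↦ v ∧ ξ`. -/
def creation {n : ℕ} (v : Fin n → ℂ) : Module.End ℂ (Ext n) :=
  LinearMap.mulLeft ℂ (ExteriorAlgebra.ι ℂ v)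

/-- The linear form `w ↦ ⟨v, w⟩ = ∑ⱼ conj(vⱼ) wⱼ` on `ℂⁿ`. -/
def hermForm {n : ℕ} (v : Fin n → ℂ) : Module.Dual ℂ (Fin n → ℂ) :=
  ∑ j, star (v j) • LinearMap.proj j

/-- The annihilation operator: contraction with `v` by means of the Hermitian inner product,
`w₁ ∧ ⋯ ∧ wₖ ↦ ∑ⱼ (-1)^(j+1) ⟨v, wⱼ⟩ w₁ ∧ ⋯ ŵⱼ ⋯ ∧ wₖ`. -/
def annihilation {n : ℕ} (v : Fin n → ℂ) : Module.End ℂ (Ext n) :=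
  CliffordAlgebra.contractLeft (Q := (0 : QuadraticForm ℂ (Fin n → ℂ))) (hermForm v)

/-- The identification `ℝ²ⁿ ≅ ℂⁿ` sending `(x₁, …, xₙ, y₁, …, yₙ)` to `(xⱼ + i yⱼ)ⱼ`. -/
def toComplex (n : ℕ) : (Fin (2 * n) → ℝ) →ₗ[ℝ] (Fin n → ℂ) where
  toFun v j := ⟨v ⟨j, by omega⟩, v ⟨n + j, by omega⟩⟩
  map_add' _ _ := rfl
  map_smul' r v := by
    ext j
    apply Complex.ext <;> simp

theorem hermForm_apply {n : ℕ} (v w : Fin n → ℂ) : hermForm v w = ∑ j, star (v j) * w j := by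
  simp [hermForm]

theorem hermForm_self (n : ℕ) (v : Fin (2 * n) → ℝ) :
    hermForm (toComplex n v) (toComplex n v) = ((-(negForm (2 * n) v) : ℝ) : ℂ) := by
  have h : (-(negForm (2 * n) v) : ℝ)
      = ∑ j : Fin n, (v ⟨j, by omega⟩ * v ⟨j, by omega⟩
        + v ⟨n + j, by omega⟩ * v ⟨n + j, by omega⟩) := by
    rw [QuadraticMap.weightedSumSquares_apply, Finset.sum_add_distrib,
      ← (finCongr (two_mul n).symm).sum_comp, Fin.sum_univ_add]
    simp only [neg_smul, one_smul, Finset.sum_neg_distrib, neg_add, neg_neg]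
    rfl
  rw [h, hermForm_apply, Complex.ofReal_sum]
  refine Finset.sum_congr rfl fun j _ => ?_
  apply Complex.ext <;> simp [toComplex]; ring

/-- Clifford multiplication by a vector of `ℝ²ⁿ ≅ ℂⁿ` on `Λ*ℂⁿ`: `v ↦ (v ∧ ·) - ι_v`. -/
def cliffordMul (n : ℕ) : (Fin (2 * n) → ℝ) →ₗ[ℝ] Module.End ℂ (Ext n) where
  toFun v := creation (toComplex n v) - annihilation (toComplex n v)
  map_add' v w := by
    have h : hermForm (toComplex n (v + w))
        = hermForm (toComplex n v) + hermForm (toComplex n w) := by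
      simp [hermForm, add_smul, Finset.sum_add_distrib]
    refine LinearMap.ext fun ξ => ?_
    rw [annihilation, h]
    simp only [creation, annihilation, LinearMap.sub_apply, LinearMap.add_apply,
      LinearMap.mulLeft_apply, map_add, add_mul]
    abel
  map_smul' r v := by
    have h : hermForm (toComplex n (r • v)) = (r : ℂ) • hermForm (toComplex n v) := by
      simp [hermForm, Finset.smul_sum, smul_smul]
    have h' : toComplex n (r • v) = (r : ℂ) • toComplex n v := by
      rw [map_smul]; rfl
    refine LinearMap.ext fun ξ => ?_
    rw [annihilation, h, h']
    simp only [creation, annihilation, LinearMap.sub_apply, LinearMap.smul_apply,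
      LinearMap.mulLeft_apply, map_smul, smul_mul_assoc, RingHom.id_apply, smul_sub]
    simp only [← Complex.coe_smul]

theorem cliffordMul_mul_self (n : ℕ) (v : Fin (2 * n) → ℝ) :
    cliffordMul n v * cliffordMul n v = algebraMap ℝ _ (negForm (2 * n) v) := by
  have key (u : Fin n → ℂ) (ξ : Ext n) :
      (creation u - annihilation u) ((creation u - annihilation u) ξ) = -(hermForm u u • ξ) := by
    have h0 : ExteriorAlgebra.ι ℂ u * (ExteriorAlgebra.ι ℂ u * ξ) = 0 := by
      rw [← mul_assoc, ExteriorAlgebra.ι_sq_zero, zero_mul]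
    have h1 : annihilation u (ExteriorAlgebra.ι ℂ u * ξ)
        = hermForm u u • ξ - ExteriorAlgebra.ι ℂ u * annihilation u ξ :=
      CliffordAlgebra.contractLeft_ι_mul (Q := (0 : QuadraticForm ℂ (Fin n → ℂ))) (hermForm u) u ξ
    have h2 : annihilation u (annihilation u ξ) = 0 :=
      CliffordAlgebra.contractLeft_contractLeft (Q := (0 : QuadraticForm ℂ (Fin n → ℂ)))
        (hermForm u) ξ
    simp only [LinearMap.sub_apply, map_sub, h2]
    simp only [creation, LinearMap.mulLeft_apply, h0, h1]
    abel
  refine LinearMap.ext fun ξ => ?_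
  refine (key (toComplex n v) ξ).trans ?_
  rw [hermForm_self, ← neg_smul, ← Complex.ofReal_neg, neg_neg, Module.algebraMap_end_apply,
    Complex.coe_smul]

/-- The Clifford module `Λ*ℂⁿ` over the Clifford algebra of `ℝ²ⁿ`. -/
def cliffordModule (n : ℕ) : Cl (2 * n) →ₐ[ℝ] Module.End ℂ (Ext n) :=
  CliffordAlgebra.lift (negForm (2 * n)) ⟨cliffordMul n, cliffordMul_mul_self n⟩

/-- The Dirac spinor representation of `Spin(2n)` on `Λ*ℂⁿ`, the restriction of the Clifford
module structure. -/
def diracRep (n : ℕ) : Representation ℂ (Spin (2 * n)) (Ext n) :=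
  (cliffordModule n : Cl (2 * n) →* Module.End ℂ (Ext n)).comp (Spin (2 * n)).subtype

end SpinSU

end

open scoped Matrix.Norms.Elementwise

/-! The Clifford module `Λ*ℂⁿ` is faithful, so at most one spin element acts as a given `g`. If one
exists for every `g`, then `ψ` is determined and automatically multiplicative. It is smooth because
`g ↦ Λ*g` is polynomial and the module map has a linear left inverse.

Existence (`exists_diracRep_eq_extRep`): unitary matrices are products of complex reflections `1 + s
u u*`. Such a reflection acts on `Λ*ℂⁿ` as `1 + s u ∧ ι_u`. This is `μ` times the Clifford product
of two unit vectors of the line `ℂu`, where `μ² = 1 + s` is the determinant. Hence a unitary `g`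
acts as a square root of `det g` times a spin element. For `det g = 1` the root is `±1`, and `-1`
lies in the spin group when `n > 0`.

Faithfulness (`cliffordModule_injective`): the kernel is an ideal stable under the grade involution,
hence under contractions. A nonzero such subspace contains `1`, which does not act as zero. -/

/-! ### Contractions in exterior and Clifford algebras -/

section Contraction

open CliffordAlgebra

variable {R M : Type*} [CommRing R] [AddCommGroup M] [Module R M]

/-- The linear map `v ↦ v + d v • u` acts on the exterior algebra as `1 + u ∧ (d⌋·)`. -/
theorem ExteriorAlgebra.map_id_add_smulRight (d : Module.Dual R M) (u : M)
    (x : ExteriorAlgebra R M) :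
    ExteriorAlgebra.map (LinearMap.id + d.smulRight u) x
      = x + ExteriorAlgebra.ι R u * contractLeft (Q := (0 : QuadraticForm R M)) d x := by
  induction x using CliffordAlgebra.left_induction with
  | algebraMap r =>
    rw [contractLeft_algebraMap, mul_zero, add_zero]
    exact AlgHom.commutes _ r
  | add x y hx hy => simp only [map_add, hx, hy, mul_add]; abel
  | ι_mul x v hx =>
    have huu : ExteriorAlgebra.ι R u * ExteriorAlgebra.ι R u = 0 := ExteriorAlgebra.ι_sq_zero u
    have huv : ExteriorAlgebra.ι R u * ExteriorAlgebra.ι R v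
        = -(ExteriorAlgebra.ι R v * ExteriorAlgebra.ι R u) :=
      eq_neg_of_add_eq_zero_left (ExteriorAlgebra.ι_add_mul_swap u v)
    rw [map_mul, hx, contractLeft_ι_mul]
    change ExteriorAlgebra.map _ (ExteriorAlgebra.ι R v) * _
      = ExteriorAlgebra.ι R v * x + ExteriorAlgebra.ι R u * (_ - ExteriorAlgebra.ι R v * _)
    rw [ExteriorAlgebra.map_apply_ι]
    simp only [LinearMap.add_apply, LinearMap.id_apply, LinearMap.smulRight_apply, map_add,
      map_smul, add_mul, mul_add, mul_sub, smul_mul_assoc, mul_smul_comm, ← mul_assoc, huu, huv,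
      zero_mul, smul_zero, neg_mul]
    abel

theorem ExteriorAlgebra.map_zero_apply (x : ExteriorAlgebra R M) :
    ExteriorAlgebra.map (0 : M →ₗ[R] M) x = algebraMap R _ (ExteriorAlgebra.algebraMapInv x) := by
  have h : ExteriorAlgebra.map (0 : M →ₗ[R] M)
      = (Algebra.ofId R _).comp ExteriorAlgebra.algebraMapInv := by
    ext v
    simp [ExteriorAlgebra.algebraMapInv]
  rw [h]
  rfl

/-- An element of the exterior algebra of a coordinate space that is killed by the contractions
with all coordinates is a scalar. -/
theorem ExteriorAlgebra.eq_algebraMap_of_contractLeft_proj_eq_zero {ι : Type*} [Fintype ι]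
    [DecidableEq ι] (x : ExteriorAlgebra R (ι → R))
    (h : ∀ i, contractLeft (Q := (0 : QuadraticForm R (ι → R))) (LinearMap.proj i) x = 0) :
    x = algebraMap R _ (ExteriorAlgebra.algebraMapInv x) := by
  have key (s : Finset ι) : ∃ f : (ι → R) →ₗ[R] (ι → R), ExteriorAlgebra.map f x = x ∧
      ∀ v, f v = fun i => if i ∈ s then 0 else v i := by
    induction s using Finset.induction_on with
    | empty => exact ⟨LinearMap.id, by rw [ExteriorAlgebra.map_id]; rfl, fun v => by simp⟩
    | insert j s hj ih =>
      obtain ⟨f, hf, hfv⟩ := ih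
      -- The new factor erases the `j`-th coordinate; it fixes `x` because the contraction of `x`
      -- with that coordinate vanishes.
      refine ⟨(LinearMap.id + (LinearMap.proj j).smulRight (-Pi.single j 1)) ∘ₗ f, ?_, fun v => ?_⟩
      · rw [← ExteriorAlgebra.map_comp_map, AlgHom.comp_apply, hf,
          ExteriorAlgebra.map_id_add_smulRight, h, mul_zero, add_zero]
      · rw [LinearMap.comp_apply, hfv]
        ext i
        by_cases hij : i = j
        · subst hij; simp [hj]
        · simp [hij, hj, Finset.mem_insert]
  obtain ⟨f, hf, hfv⟩ := key Finset.univ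
  have : f = 0 := LinearMap.ext fun v => by rw [hfv]; ext; simp
  rw [← ExteriorAlgebra.map_zero_apply, ← this, hf]

/-- `equivExterior` commutes with contractions and fixes scalars, so the exterior case transfers. -/
theorem CliffordAlgebra.eq_algebraMap_of_contractLeft_proj_eq_zero {ι : Type*} [Fintype ι]
    [Invertible (2 : R)] [DecidableEq ι] {Q : QuadraticForm R (ι → R)} (x : CliffordAlgebra Q)
    (h : ∀ i, contractLeft (LinearMap.proj i) x = 0) : ∃ r, x = algebraMap R _ r := by
  have h' := ExteriorAlgebra.eq_algebraMap_of_contractLeft_proj_eq_zero (equivExterior Q x)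
    fun i => by
      refine (changeForm_contractLeft changeForm.associated_neg_proof _ x).symm.trans ?_
      rw [h, map_zero]
  exact ⟨_, (equivExterior Q).injective
    (h'.trans (changeForm_algebraMap changeForm.associated_neg_proof _).symm)⟩

/-- A nonzero subspace of a Clifford algebra that is stable under contractions contains `1`. -/
theorem CliffordAlgebra.one_mem_of_contractLeft_mem {K ι : Type*} [Field K] [Invertible (2 : K)]
    [Fintype ι] [DecidableEq ι] {Q : QuadraticForm K (ι → K)} (W : Submodule K (CliffordAlgebra Q))
    (hW : ∀ i, ∀ x ∈ W, contractLeft (LinearMap.proj i) x ∈ W) (hne : W ≠ ⊥) : 1 ∈ W := by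
  have key (s : Finset ι) :
      ∃ x ∈ W, x ≠ 0 ∧ ∀ i ∈ s, contractLeft (LinearMap.proj i) x = 0 := by
    induction s using Finset.induction_on with
    | empty =>
      obtain ⟨x, hx, hx0⟩ := W.ne_bot_iff.1 hne
      exact ⟨x, hx, hx0, by simp⟩
    | insert j s hj ih =>
      obtain ⟨x, hx, hx0, hxs⟩ := ih
      by_cases hjx : contractLeft (LinearMap.proj j) x = 0
      · exact ⟨x, hx, hx0, by simpa [hjx] using hxs⟩
      -- Contractions square to zero and anticommute, so contracting with `j` keeps the vanishings
      -- already obtained.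
      · refine ⟨_, hW j x hx, hjx, fun i hi => ?_⟩
        rcases Finset.mem_insert.1 hi with rfl | hi
        · exact contractLeft_contractLeft _ _
        · rw [contractLeft_comm, hxs i hi, map_zero, neg_zero]
  obtain ⟨x, hx, hx0, hxs⟩ := key Finset.univ
  obtain ⟨r, rfl⟩ := eq_algebraMap_of_contractLeft_proj_eq_zero x fun i => hxs i (Finset.mem_univ i)
  have hr : r ≠ 0 := by rintro rfl; simp at hx0
  simpa [Algebra.algebraMap_eq_smul_one, smul_smul, hr] using W.smul_mem r⁻¹ hx

/-- Contraction is a graded commutator with a vector, so it preserves any two-sided ideal stable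
under `involute`. -/
theorem CliffordAlgebra.contractLeft_polar {Q : QuadraticForm R M} (e : M)
    (x : CliffordAlgebra Q) :
    contractLeft (QuadraticMap.polarBilin Q e) x = ι Q e * x - involute x * ι Q e := by
  induction x using CliffordAlgebra.left_induction with
  | algebraMap r =>
    rw [contractLeft_algebraMap, AlgHom.commutes, Algebra.commutes, sub_self]
  | add x y hx hy => simp only [map_add, hx, hy, mul_add, add_mul]; abel
  | ι_mul x v hx =>
    have h : ι Q e * ι Q v = algebraMap R _ (QuadraticMap.polar Q e v) - ι Q v * ι Q e :=
      eq_sub_of_add_eq (ι_mul_ι_add_swap e v)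
    rw [contractLeft_ι_mul, hx, map_mul, involute_ι, ← mul_assoc, h,
      QuadraticMap.polarBilin_apply_apply, Algebra.smul_def]
    noncomm_ring

theorem CliffordAlgebra.involute_contractLeft {Q : QuadraticForm R M} (d : Module.Dual R M)
    (x : CliffordAlgebra Q) :
    involute (contractLeft d x) = -contractLeft d (involute x) := by
  induction x using CliffordAlgebra.left_induction with
  | algebraMap r => simp
  | add x y hx hy => simp only [map_add, hx, hy]; abel
  | ι_mul x v hx =>
    simp only [contractLeft_ι_mul, map_sub, map_smul, map_mul, involute_ι, hx, neg_mul, map_neg]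
    noncomm_ring

end Contraction

/-! ### Faithfulness of the Clifford module -/

namespace SpinSU

section Injective

open CliffordAlgebra

theorem cliffordModule_ι (n : ℕ) (v : Fin (2 * n) → ℝ) :
    cliffordModule n (ι _ v) = cliffordMul n v :=
  lift_ι_apply _ _ _

theorem cliffordModule_algebraMap (n : ℕ) (r : ℝ) (ξ : Ext n) :
    cliffordModule n (algebraMap ℝ _ r) ξ = (r : ℂ) • ξ := by
  rw [AlgHom.commutes, Module.algebraMap_end_apply, Complex.coe_smul]

theorem cliffordMul_apply (n : ℕ) (v : Fin (2 * n) → ℝ) (ξ : Ext n) :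
    cliffordMul n v ξ
      = ExteriorAlgebra.ι ℂ (toComplex n v) * ξ - annihilation (toComplex n v) ξ :=
  rfl

/-- The grade involution of `Λ*ℂⁿ`. -/
def extInvolute (n : ℕ) : Ext n →ₐ[ℂ] Ext n :=
  involute (Q := (0 : QuadraticForm ℂ (Fin n → ℂ)))

theorem extInvolute_ι {n : ℕ} (v : Fin n → ℂ) :
    extInvolute n (ExteriorAlgebra.ι ℂ v) = -ExteriorAlgebra.ι ℂ v :=
  involute_ι v

theorem extInvolute_extInvolute {n : ℕ} (ξ : Ext n) : extInvolute n (extInvolute n ξ) = ξ :=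
  involute_involute ξ

theorem involute_annihilation {n : ℕ} (v : Fin n → ℂ) (ξ : Ext n) :
    extInvolute n (annihilation v ξ) = -annihilation v (extInvolute n ξ) :=
  involute_contractLeft (hermForm v) ξ

/-- Creation and annihilation operators are odd, so conjugation by the grade involution of `Λ*ℂⁿ`
negates Clifford multiplication by vectors. -/
theorem cliffordModule_involute (n : ℕ) (x : Cl (2 * n)) (ξ : Ext n) :
    cliffordModule n (involute x) (extInvolute n ξ)
      = extInvolute n (cliffordModule n x ξ) := by
  induction x using CliffordAlgebra.left_induction generalizing ξ with
  | algebraMap r =>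
    rw [AlgHom.commutes involute, cliffordModule_algebraMap, cliffordModule_algebraMap]
    exact (LinearMap.map_smul (extInvolute n).toLinearMap
      (r : ℂ) ξ).symm
  | add x y hx hy => simp only [map_add, hx, hy, LinearMap.add_apply]
  | ι_mul x v hx =>
    rw [map_mul, map_mul, map_mul, involute_ι, map_neg, cliffordModule_ι, Module.End.mul_apply, hx]
    rw [LinearMap.neg_apply, Module.End.mul_apply, cliffordMul_apply, cliffordMul_apply,
      map_sub, map_mul, involute_annihilation, extInvolute_ι, neg_mul, sub_neg_eq_add, neg_sub, sub_eq_neg_add]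

theorem polar_negForm_single (m : ℕ) (i : Fin m) (c : ℝ) :
    QuadraticMap.polarBilin (negForm m) (Pi.single i c) = (-2 * c) • LinearMap.proj i := by
  refine LinearMap.ext fun v => ?_
  have h (j : Fin m) :
      (-1 : ℝ) • (((Pi.single i c : Fin m → ℝ) j + v j) * ((Pi.single i c : Fin m → ℝ) j + v j))
      - (-1 : ℝ) • ((Pi.single i c : Fin m → ℝ) j * (Pi.single i c : Fin m → ℝ) j)
      - (-1 : ℝ) • (v j * v j) = if j = i then -2 * c * v i else 0 := by
    by_cases hj : j = i
    · subst hj; simp; ring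
    · simp [hj]
  simp only [QuadraticMap.polarBilin_apply_apply, QuadraticMap.polar,
    QuadraticMap.weightedSumSquares_apply, Pi.add_apply, ← Finset.sum_sub_distrib, h]
  simp

theorem cliffordModule_injective (n : ℕ) : Function.Injective (cliffordModule n) := by
  let W : Submodule ℝ (Cl (2 * n)) := LinearMap.ker (cliffordModule n).toLinearMap
  have hmem (x) : x ∈ W ↔ cliffordModule n x = 0 := LinearMap.mem_ker
  have hinv (x) (hx : x ∈ W) : involute x ∈ W := by
    rw [hmem] at hx ⊢
    refine LinearMap.ext fun ξ => ?_
    have h := cliffordModule_involute n x (extInvolute n ξ)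
    rw [extInvolute_extInvolute, hx] at h
    exact h.trans (map_zero _)
  have hbot : W = ⊥ := by
    by_contra hne
    have h1 : (1 : Cl (2 * n)) ∈ W := by
      refine one_mem_of_contractLeft_mem W (fun i x hx => ?_) hne
      -- The factor `-1 / 2` makes the polar form exactly the `i`-th coordinate.
      have h := contractLeft_polar (Q := negForm (2 * n)) (Pi.single i (-1 / 2)) x
      rw [polar_negForm_single] at h
      norm_num at h
      rw [h, hmem, map_sub, map_mul, map_mul, (hmem _).1 hx, (hmem _).1 (hinv x hx)]
      simp
    rw [hmem, map_one] at h1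
    exact one_ne_zero h1
  exact LinearMap.ker_eq_bot.1 hbot

end Injective

end SpinSU

/-! ### Unit vectors and the spin group -/

section SpinGroup

open CliffordAlgebra

variable {R M : Type*} [CommRing R] [AddCommGroup M] [Module R M] {Q : QuadraticForm R M}

theorem pinGroup.ι_mem {a : M} (ha : Q a = -1) : ι Q a ∈ pinGroup Q := by
  have h : ι Q a * ι Q a = -1 := by rw [ι_sq_scalar, ha, map_neg, map_one]
  refine ⟨⟨⟨ι Q a, -ι Q a, by rw [mul_neg, h, neg_neg], by rw [neg_mul, h, neg_neg]⟩,
    Subgroup.subset_closure ⟨a, rfl⟩, rfl⟩, ?_⟩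
  exact Unitary.mem_iff.2 (by rw [star_ι, neg_mul, mul_neg, h, neg_neg]; exact ⟨rfl, rfl⟩)

theorem spinGroup.ι_mul_ι_mem {a b : M} (ha : Q a = -1) (hb : Q b = -1) :
    ι Q a * ι Q b ∈ spinGroup Q :=
  ⟨mul_mem (pinGroup.ι_mem ha) (pinGroup.ι_mem hb), ι_mul_ι_mem_evenOdd_zero Q a b⟩

theorem spinGroup.neg_mem {a : M} (ha : Q a = -1) {x : CliffordAlgebra Q}
    (hx : x ∈ spinGroup Q) : -x ∈ spinGroup Q := by
  have h := mul_mem (spinGroup.ι_mul_ι_mem ha ha) hx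
  rwa [ι_sq_scalar, ha, map_neg, map_one, neg_one_mul] at h

end SpinGroup

/-! ### Complex reflections and lifting of unitary matrices -/

namespace SpinSU

open Matrix

variable {n : ℕ}

/-- The matrix `1 + s u u*`, a complex reflection if `u` is a unit vector and `‖1 + s‖ = 1`. -/
def refl (u : Fin n → ℂ) (s : ℂ) : Matrix (Fin n) (Fin n) ℂ :=
  1 + s • vecMulVec u (star u)

theorem refl_mulVec (u : Fin n → ℂ) (s : ℂ) (v : Fin n → ℂ) :
    refl u s *ᵥ v = v + (s * (star u ⬝ᵥ v)) • u := by
  ext i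
  simp [refl, add_mulVec, smul_mulVec, vecMulVec_mulVec]
  ring

theorem det_refl (u : Fin n → ℂ) (s : ℂ) : (refl u s).det = 1 + s * (star u ⬝ᵥ u) := by
  have h : refl u s = 1 + replicateCol Unit (s • u) * replicateRow Unit (star u) := by
    rw [refl, ← vecMulVec_eq, smul_vecMulVec]
  rw [h, det_one_add_replicateCol_mul_replicateRow, dotProduct_smul, smul_eq_mul]

theorem refl_mul_refl {u : Fin n → ℂ} (hu : star u ⬝ᵥ u = 1) (s t : ℂ) :
    refl u s * refl u t = refl u (s + t + s * t) := by
  have h : vecMulVec u (star u) * vecMulVec u (star u) = vecMulVec u (star u) := by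
    rw [vecMulVec_mul_vecMulVec, hu, one_smul]
  simp only [refl, mul_add, add_mul, mul_one, one_mul, smul_mul_smul_comm, h, add_smul]
  abel

theorem star_refl (u : Fin n → ℂ) (s : ℂ) : star (refl u s) = refl u (star s) := by
  rw [refl, refl, star_add, star_one, star_smul, star_eq_conjTranspose, conjTranspose_vecMulVec,
    star_star]

theorem refl_zero (u : Fin n → ℂ) : refl u 0 = 1 := by simp [refl]

theorem refl_mem_unitaryGroup {u : Fin n → ℂ} (hu : star u ⬝ᵥ u = 1) {s : ℂ}
    (hs : star (1 + s) * (1 + s) = 1) : refl u s ∈ unitaryGroup (Fin n) ℂ := by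
  rw [mem_unitaryGroup_iff', star_refl, refl_mul_refl hu, ← refl_zero u]
  congr 1
  rw [star_add, star_one] at hs
  linear_combination hs

theorem hermForm_eq_dotProduct (u v : Fin n → ℂ) : hermForm u v = star u ⬝ᵥ v :=
  hermForm_apply u v

theorem map_toLin'_refl (u : Fin n → ℂ) (s : ℂ) (ξ : Ext n) :
    ExteriorAlgebra.map (toLin' (refl u s)) ξ
      = ξ + s • (ExteriorAlgebra.ι ℂ u * annihilation u ξ) := by
  have h : toLin' (refl u s) = LinearMap.id + (hermForm u).smulRight (s • u) := by
    refine LinearMap.ext fun v => ?_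
    rw [toLin'_apply, refl_mulVec, ← hermForm_eq_dotProduct]
    simp only [LinearMap.add_apply, LinearMap.id_apply, LinearMap.smulRight_apply, smul_smul,
      mul_comm]
  rw [h, ExteriorAlgebra.map_id_add_smulRight, map_smul, smul_mul_assoc]
  rfl

theorem annihilation_ι_mul (u v : Fin n → ℂ) (ξ : Ext n) :
    annihilation u (ExteriorAlgebra.ι ℂ v * ξ)
      = (star u ⬝ᵥ v) • ξ - ExteriorAlgebra.ι ℂ v * annihilation u ξ := by
  rw [← hermForm_eq_dotProduct]
  exact CliffordAlgebra.contractLeft_ι_mul (Q := (0 : QuadraticForm ℂ (Fin n → ℂ))) (hermForm u) v ξ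

theorem annihilation_annihilation (u : Fin n → ℂ) (ξ : Ext n) :
    annihilation u (annihilation u ξ) = 0 :=
  CliffordAlgebra.contractLeft_contractLeft (Q := (0 : QuadraticForm ℂ (Fin n → ℂ))) (hermForm u) ξ

theorem annihilation_smul (c : ℂ) (u : Fin n → ℂ) (ξ : Ext n) :
    annihilation (c • u) ξ = star c • annihilation u ξ := by
  have h : hermForm (c • u) = star c • hermForm u := by
    simp [hermForm, Finset.smul_sum, smul_smul]
  rw [annihilation, h, map_smul]
  rfl

theorem toComplex_surjective (n : ℕ) : Function.Surjective (toComplex n) := by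
  intro w
  refine ⟨fun i => Fin.append (fun j => (w j).re) (fun j => (w j).im) (Fin.cast (two_mul n) i), ?_⟩
  ext j
  apply Complex.ext
  · exact Fin.append_left (fun j => (w j).re) (fun j => (w j).im) j
  · exact Fin.append_right (fun j => (w j).re) (fun j => (w j).im) j

theorem negForm_eq_neg_one {a : Fin (2 * n) → ℝ}
    (ha : star (toComplex n a) ⬝ᵥ toComplex n a = 1) : negForm (2 * n) a = -1 := by
  rw [← hermForm_eq_dotProduct, hermForm_self] at ha
  have : -(negForm (2 * n) a) = 1 := by exact_mod_cast ha
  linarith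

/-- The matrices `g` whose action on `Λ*ℂⁿ` is a square root of `det g` times the action of an
element of the spin group. -/
def spinLiftable (n : ℕ) : Submonoid (Matrix (Fin n) (Fin n) ℂ) where
  carrier := {g | ∃ (μ : ℂ) (x : Spin (2 * n)), μ ^ 2 = g.det ∧
    ∀ ξ, ExteriorAlgebra.map (toLin' g) ξ = μ • diracRep n x ξ}
  one_mem' := ⟨1, 1, by simp, fun ξ => by
    rw [toLin'_one, ExteriorAlgebra.map_id, map_one, one_smul]; rfl⟩
  mul_mem' := by
    rintro g h ⟨μ, x, hμ, hx⟩ ⟨ν, y, hν, hy⟩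
    refine ⟨μ * ν, x * y, by rw [mul_pow, hμ, hν, det_mul], fun ξ => ?_⟩
    rw [toLin'_mul, ← ExteriorAlgebra.map_comp_map, AlgHom.comp_apply, hy, map_smul, hx, map_mul,
      Module.End.mul_apply, smul_smul, mul_comm]

theorem refl_mem_spinLiftable {u : Fin n → ℂ} (hu : star u ⬝ᵥ u = 1) {s : ℂ}
    (hs : star (1 + s) * (1 + s) = 1) : refl u s ∈ spinLiftable n := by
  obtain ⟨μ, hμ⟩ := IsAlgClosed.exists_pow_nat_eq (1 + s) two_pos
  have hμ1 : star μ * μ = 1 := by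
    have h1 : ‖1 + s‖ = 1 := by
      have : ‖star (1 + s) * (1 + s)‖ = 1 := by rw [hs, norm_one]
      rw [norm_mul, norm_star] at this
      nlinarith [norm_nonneg (1 + s)]
    have h2 : ‖μ‖ = 1 := by
      rw [← hμ, norm_pow] at h1
      nlinarith [norm_nonneg μ]
    rw [mul_comm]
    exact (Complex.mul_conj' μ).trans (by rw [h2]; simp)
  obtain ⟨a, ha⟩ := toComplex_surjective n u
  -- With this `b`, the product of `u` and `b` acts as `star μ + (μ - star μ) u ∧ ι_u`; multiplying
  -- by `μ` gives `1 + (μ² - 1) u ∧ ι_u`.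
  obtain ⟨b, hb⟩ := toComplex_surjective n (-star μ • u)
  have hQa : negForm (2 * n) a = -1 := negForm_eq_neg_one (by rw [ha, hu])
  have hQb : negForm (2 * n) b = -1 := negForm_eq_neg_one (by
    rw [hb, star_smul, smul_dotProduct, dotProduct_smul, hu]
    simp only [star_neg, star_star, smul_eq_mul, mul_one]
    linear_combination hμ1)
  refine ⟨μ, ⟨_, spinGroup.ι_mul_ι_mem hQa hQb⟩, by rw [hμ, det_refl, hu, mul_one], fun ξ => ?_⟩
  have hc : diracRep n ⟨_, spinGroup.ι_mul_ι_mem hQa hQb⟩ ξ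
      = cliffordMul n a (cliffordMul n b ξ) := by
    rw [← cliffordModule_ι, ← cliffordModule_ι, ← Module.End.mul_apply,
      ← map_mul (cliffordModule n)]
    rfl
  have hιι (η : Ext n) : ExteriorAlgebra.ι ℂ u * (ExteriorAlgebra.ι ℂ u * η) = 0 := by
    rw [← mul_assoc, ExteriorAlgebra.ι_sq_zero, zero_mul]
  rw [hc, cliffordMul_apply, cliffordMul_apply, ha, hb, map_toLin'_refl, annihilation_smul,
    map_smul, star_neg, star_star, smul_mul_assoc, map_sub, map_smul, map_smul,
    annihilation_ι_mul, hu, annihilation_annihilation, smul_zero, sub_zero, one_smul, mul_sub,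
    mul_smul_comm, mul_smul_comm, hιι, smul_zero, zero_sub]
  have hs' : s = μ ^ 2 - 1 := by rw [hμ]; ring
  generalize ExteriorAlgebra.ι ℂ u * annihilation u ξ = η
  rw [hs']
  match_scalars
  · linear_combination -hμ1
  · linear_combination hμ1

open scoped ComplexOrder in
theorem exists_refl_mulVec_eq {a b : Fin n → ℂ} (hab : a ≠ b)
    (h : star a ⬝ᵥ a = star b ⬝ᵥ b) :
    ∃ (u : Fin n → ℂ) (s : ℂ), star u ⬝ᵥ u = 1 ∧ star (1 + s) * (1 + s) = 1 ∧
      refl u s *ᵥ a = b ∧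
      ∀ w, star a ⬝ᵥ w = 0 → star b ⬝ᵥ w = 0 → refl u s *ᵥ w = w := by
  have hpos : 0 < star (a - b) ⬝ᵥ (a - b) :=
    dotProduct_star_self_pos_iff.2 (sub_ne_zero.2 hab)
  obtain ⟨r, hr0, hr⟩ : ∃ r : ℝ, 0 < r ∧ (r : ℂ) ^ 2 = star (a - b) ⬝ᵥ (a - b) := by
    obtain ⟨hre, him⟩ := Complex.pos_iff.1 hpos
    refine ⟨√(star (a - b) ⬝ᵥ (a - b)).re, Real.sqrt_pos.2 hre, ?_⟩
    rw [← Complex.ofReal_pow, Real.sq_sqrt hre.le]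
    exact Complex.ext rfl him
  have hr1 : (r : ℂ) ≠ 0 := by exact_mod_cast hr0.ne'
  have hrs : star (r : ℂ) = r := Complex.conj_ofReal r
  set z := star (a - b) ⬝ᵥ a with hz
  have hzb : star (a - b) ⬝ᵥ b = -star z := by
    rw [hz, star_sub, sub_dotProduct, sub_dotProduct, star_sub, ← star_dotProduct_star,
      ← star_dotProduct_star, star_star, star_star, h, neg_sub]
  have hzz : z + star z = (r : ℂ) ^ 2 := by
    rw [hr, dotProduct_sub, hzb, sub_neg_eq_add]
  have hz0 : z ≠ 0 := by
    intro h0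
    rw [h0, star_zero, add_zero] at hzz
    exact pow_ne_zero 2 hr1 hzz.symm
  have hz0' : star z ≠ 0 := star_ne_zero.2 hz0
  have hu (w) : star ((r : ℂ)⁻¹ • (a - b)) ⬝ᵥ w = (r : ℂ)⁻¹ * (star (a - b) ⬝ᵥ w) := by
    rw [star_smul, star_inv₀, hrs, smul_dotProduct, smul_eq_mul]
  -- Here `u` is the normalized difference, and `s` solves `s ⟨u, a⟩ u = b - a`. Equality of norms
  -- gives `r² = z + star z`, so `1 + s = -star z / z` has modulus one.
  refine ⟨(r : ℂ)⁻¹ • (a - b), -(r : ℂ) ^ 2 / z, ?_, ?_, ?_, fun w hwa hwb => ?_⟩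
  · rw [hu, dotProduct_smul, smul_eq_mul, ← hr]
    field_simp
  · have : 1 + -(r : ℂ) ^ 2 / z = -star z / z := by
      rw [← hzz]; field_simp; ring
    rw [this, star_div₀, star_neg, star_star]
    field_simp
  · rw [refl_mulVec, hu, ← hz, smul_smul]
    have : -(r : ℂ) ^ 2 / z * ((r : ℂ)⁻¹ * z) * (r : ℂ)⁻¹ = -1 := by field_simp
    rw [this]
    simp
  · rw [refl_mulVec, hu, star_sub, sub_dotProduct, hwa, hwb]
    simp

theorem mulVec_dotProduct_mulVec {g : Matrix (Fin n) (Fin n) ℂ} (hg : g ∈ unitaryGroup (Fin n) ℂ)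
    (v w : Fin n → ℂ) : star (g *ᵥ v) ⬝ᵥ (g *ᵥ w) = star v ⬝ᵥ w := by
  rw [star_mulVec, ← dotProduct_mulVec, mulVec_mulVec, ← star_eq_conjTranspose,
    mem_unitaryGroup_iff'.1 hg, one_mulVec]

/-- Descending induction on the number `k` of initial basis vectors fixed by `g`. A reflection
taking `e_k` to `g e_k` fixes the earlier basis vectors, which are orthogonal to both; dividing it
out yields a matrix fixing one more. -/
theorem unitaryGroup_le_spinLiftable (n : ℕ) : unitaryGroup (Fin n) ℂ ≤ spinLiftable n := by
  have key (k : ℕ) (hk : k ≤ n) : ∀ g ∈ unitaryGroup (Fin n) ℂ,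
      (∀ j : Fin n, j < k → g *ᵥ Pi.single j 1 = Pi.single j 1) → g ∈ spinLiftable n := by
    induction hk using Nat.decreasingInduction with
    | self =>
      intro g _ h
      have : g = 1 := by
        refine toLin'.injective ((Pi.basisFun ℂ (Fin n)).ext fun j => ?_)
        simpa using h j j.2
      exact this ▸ one_mem _
    | of_succ k hk ih =>
      intro g hg h
      set e : Fin n → ℂ := Pi.single ⟨k, hk⟩ 1 with he
      by_cases hge : e = g *ᵥ e
      · refine ih g hg fun j hj => ?_
        rcases Nat.lt_succ_iff_lt_or_eq.1 hj with hj | hj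
        · exact h j hj
        · obtain rfl : j = ⟨k, hk⟩ := Fin.ext hj
          exact hge.symm
      obtain ⟨u, s, hu, hs, hse, hsw⟩ :=
        exists_refl_mulVec_eq hge (mulVec_dotProduct_mulVec hg e e).symm
      have hR := refl_mem_unitaryGroup hu hs
      have hRg := mul_mem (Unitary.star_mem hR) hg
      have hfix (v) (hv : refl u s *ᵥ v = g *ᵥ v) : (star (refl u s) * g) *ᵥ v = v := by
        rw [← mulVec_mulVec, ← hv, mulVec_mulVec, mem_unitaryGroup_iff'.1 hR, one_mulVec]
      have h1 : star (refl u s) * g ∈ spinLiftable n := by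
        refine ih _ hRg fun j hj => hfix _ ?_
        rcases Nat.lt_succ_iff_lt_or_eq.1 hj with hj | hj
        · have hej : star e ⬝ᵥ Pi.single j 1 = 0 := by
            have : j ≠ ⟨k, hk⟩ := fun h => hj.ne (congrArg Fin.val h)
            simp [he, this]
          rw [h j hj]
          refine hsw _ hej ?_
          rw [← h j hj, mulVec_dotProduct_mulVec hg, hej]
        · obtain rfl : j = ⟨k, hk⟩ := Fin.ext hj
          exact hse
      have h2 : g = refl u s * (star (refl u s) * g) := by
        rw [← mul_assoc, mem_unitaryGroup_iff.1 hR, one_mul]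
      rw [h2]
      exact mul_mem (refl_mem_spinLiftable hu hs) h1
  exact fun g hg => key 0 n.zero_le g hg fun j hj => absurd hj (Nat.not_lt_zero _)

theorem exists_diracRep_eq_extRep (g : SU n) : ∃ x : Spin (2 * n), diracRep n x = extRep n g := by
  obtain ⟨hgu, hgd⟩ := mem_specialUnitaryGroup_iff.1 g.2
  obtain ⟨μ, x, hμ, hx⟩ := unitaryGroup_le_spinLiftable n hgu
  -- For `n = 0` there is no unit vector to produce `-1`, but `SU(0)` is trivial.
  rcases n.eq_zero_or_pos with rfl | hn
  · exact ⟨1, by rw [map_one, Subsingleton.elim g 1, map_one]⟩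
  rcases sq_eq_sq_iff_eq_or_eq_neg.1 (hμ.trans (hgd.trans (one_pow 2).symm)) with rfl | rfl
  · exact ⟨x, LinearMap.ext fun ξ => ((hx ξ).trans (one_smul ℂ _)).symm⟩
  · have hQ : negForm (2 * n) (Pi.single ⟨0, by omega⟩ 1) = -1 := by
      simp [QuadraticMap.weightedSumSquares_apply, Pi.single_apply]
    refine ⟨⟨_, spinGroup.neg_mem hQ x.2⟩, ?_⟩
    have hneg : diracRep n ⟨_, spinGroup.neg_mem hQ x.2⟩ = -diracRep n x :=
      map_neg (cliffordModule n) _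
    rw [hneg]
    refine LinearMap.ext fun ξ => ((hx ξ).trans ?_).symm
    exact neg_one_smul ℂ (diracRep n x ξ)

/-! ### Smoothness of the action on the exterior algebra -/

section Smooth

variable {A B : Type*} [NormedAddCommGroup A] [NormedSpace ℝ A]

/-- A map into a finite-dimensional space is smooth if all its coordinates are. -/
def CoordSmooth [AddCommGroup B] [Module ℝ B] (F : A → B) : Prop :=
  ∀ l : Module.Dual ℝ B, ContDiff ℝ ∞ fun a => l (F a)

theorem CoordSmooth.add [AddCommGroup B] [Module ℝ B] {F G : A → B} (hF : CoordSmooth F)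
    (hG : CoordSmooth G) : CoordSmooth fun a => F a + G a := fun l => by
  simpa only [map_add] using (hF l).add (hG l)

theorem CoordSmooth.mul [Ring B] [Algebra ℝ B] [FiniteDimensional ℝ B] {F G : A → B}
    (hF : CoordSmooth F) (hG : CoordSmooth G) : CoordSmooth fun a => F a * G a := fun l => by
  let b := Module.finBasis ℝ B
  have h (a : A) : l (F a * G a)
      = ∑ i, ∑ j, b.coord i (F a) * (b.coord j (G a) * l (b i * b j)) := by
    conv_lhs => rw [← b.sum_repr (F a), ← b.sum_repr (G a)]
    simp only [Finset.sum_mul, Finset.mul_sum, smul_mul_assoc, mul_smul_comm, map_sum, map_smul,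
      smul_eq_mul, Module.Basis.coord_apply]
    rw [Finset.sum_comm]
    refine Finset.sum_congr rfl fun i _ => Finset.sum_congr rfl fun j _ => by ring
  simp only [h]
  exact ContDiff.sum fun i _ => ContDiff.sum fun j _ =>
    (hF _).mul ((hG _).mul contDiff_const)

end Smooth

instance finiteDimensional_real_ext (n : ℕ) : FiniteDimensional ℝ (Ext n) :=
  Module.Finite.trans ℂ (Ext n)

theorem coordSmooth_map_toLin' (n : ℕ) (ξ : Ext n) :
    CoordSmooth fun g : Matrix (Fin n) (Fin n) ℂ =>
      ExteriorAlgebra.map (Matrix.toLin' g) ξ := by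
  induction ξ using ExteriorAlgebra.induction with
  | algebraMap r =>
    intro l
    simp only [AlgHom.commutes]
    exact contDiff_const
  | ι v =>
    intro l
    let L : Matrix (Fin n) (Fin n) ℂ →ₗ[ℝ] ℝ :=
      { toFun g := l (ExteriorAlgebra.ι ℂ (g.mulVec v))
        map_add' g h := by rw [Matrix.add_mulVec, map_add, map_add]
        map_smul' r g := by
          rw [Matrix.smul_mulVec, ← Complex.coe_smul, map_smul, Complex.coe_smul, map_smul]
          rfl }
    simp only [ExteriorAlgebra.map_apply_ι, Matrix.toLin'_apply]
    exact (LinearMap.toContinuousLinearMap L).contDiff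
  | mul x y hx hy =>
    simp only [map_mul]
    exact hx.mul hy
  | add x y hx hy =>
    simp only [map_add]
    exact hx.add hy

/-- An endomorphism depends linearly on its values on a basis, so pointwise smoothness suffices. -/
theorem coordSmooth_end {A : Type*} [NormedAddCommGroup A] [NormedSpace ℝ A] {n : ℕ}
    {F : A → Module.End ℂ (Ext n)} (hF : ∀ ξ, CoordSmooth fun a => F a ξ) : CoordSmooth F := by
  intro l
  let b := Module.finBasis ℂ (Ext n)
  let E : Module.End ℂ (Ext n) →ₗ[ℝ] (Fin (Module.finrank ℂ (Ext n)) → Ext n) :=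
    LinearMap.pi fun i => LinearMap.applyₗ' ℝ (b i) ∘ₗ LinearMap.restrictScalarsₗ ℝ ℂ _ _ ℝ
  have hE : LinearMap.ker E = ⊥ := LinearMap.ker_eq_bot'.2 fun T hT =>
    b.ext fun i => congrFun hT i
  obtain ⟨L, hL⟩ := E.exists_leftInverse_of_injective hE
  have h (a : A) : l (F a) = ∑ i, (l ∘ₗ L ∘ₗ LinearMap.single ℝ (fun _ => Ext n) i) (F a (b i)) := by
    have h1 : F a = L (E (F a)) := (LinearMap.congr_fun hL (F a)).symm
    have h2 : E (F a) = ∑ i, LinearMap.single ℝ (fun _ => Ext n) i (F a (b i)) :=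
      (Finset.univ_sum_single (E (F a))).symm
    conv_lhs => rw [h1, h2]
    simp only [map_sum, LinearMap.comp_apply]
  simp only [h]
  exact ContDiff.sum fun i _ => hF _ _

end SpinSU

/-! ### Construction of the homomorphism -/

theorem mainTheorem6 (n : ℕ) :
    ∃ ψ : SpinSU.SU n →* SpinSU.Spin (2 * n),
      SpinSU.IsLieGroupHom ψ ∧ (SpinSU.diracRep n).comp ψ = SpinSU.extRep n := by
  choose f hf using SpinSU.exists_diracRep_eq_extRep (n := n)
  have hinj : Function.Injective (SpinSU.diracRep n) :=
    (SpinSU.cliffordModule_injective n).comp Subtype.val_injective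
  refine ⟨⟨⟨f, hinj (by rw [hf, map_one, map_one])⟩,
    fun g h => hinj (by simp only [map_mul, hf])⟩, fun g => ?_, MonoidHom.ext hf⟩
  obtain ⟨L, hL⟩ := (SpinSU.cliffordModule n).toLinearMap.exists_leftInverse_of_injective
    (LinearMap.ker_eq_bot.2 (SpinSU.cliffordModule_injective n))
  -- The left inverse `L` of the module map extends `ψ` smoothly to all matrices.
  refine ⟨Set.univ, fun a => L (ExteriorAlgebra.map (Matrix.toLin' a)).toLinearMap, isOpen_univ,
    Set.mem_univ _, fun l => ContDiff.contDiffOn ?_, fun h _ => ?_⟩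
  · exact SpinSU.coordSmooth_end (SpinSU.coordSmooth_map_toLin' n) (l ∘ₗ L)
  · exact (congrArg L (hf h).symm).trans (LinearMap.congr_fun hL (f h : SpinSU.Cl (2 * n)))
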